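/- Let $G$ be a locally compact (Hausdorff) abelian group with Haar measure $\mu$ and dual group $\Gamma$ (the continuous characters $\chi : G \to \mathbb{T}$, with the compact-open topology). For $a \in L^1(G)$ and $\chi\in\Gamma$ put $\widehat a(\chi) = \int_G a(s)\chi(s)\,d\mu(s)$. For $\Lambda \subset \Gamma$ let $J_\Lambda$ be the set of all $a \in L^1(G)$ such that $\widehat a$ vanishes in a neighbourhood of each $\chi\in\Lambda$, and let $K_\Lambda = \{a \in L^1(G) : \widehat a(\chi) = 0 \text{ for all } \chi\in\Lambda\}$. Let $T$ be a representation of $G$ by unitary operators on a complex Hilbert space $X$, that is, a strongly continuous homomorphism from $G$ into the group of unitary operators on $X$. For $a \in L^1(G)$ let $\widehat a(T)$ be the bounded operator on $X$ given by $\widehat a(T)x = \int_G a(s)T(s)x\,d\mu(s)$ for $x\in X$. Let $$\mathrm{Sp}(T) = \bigcap\Big\{\Lambda\subset\Gamma : \Lambda \text{ is closed and } \bigcap_{b\in J_\Lambda}\ker \widehat b(T) = X\Big\}$$ be the (Arveson) spectrum of $T$. Then, for every $a\in L^1(G)$, $$\|\widehat a(T)\| = \sup\{|\widehat a(\chi)|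 : \chi\in \mathrm{Sp}(T)\},$$ where the set on the right is bounded and the supremum of the empty set is $0$ (this only matters if $X=\{0\}$). Moreover, $\widehat a(T) = 0$ if and only if $a\in K_{\mathrm{Sp}(T)}$, that is, if and only if $\widehat a(\chi) = 0$ for all $\chi\in\mathrm{Sp}(T)$. -/

import Mathlib

open MeasureTheory Topology Filter

noncomputable section

/-- A representation of a topological group `G` (written multiplicatively) on a complex normed
space `X`: a strongly continuous homomorphism into the bounded operators on `X`, mapping the
identity element to the identity operator. -/
structure StrongRep (G X : Type*) [Group G] [TopologicalSpace G]
    [NormedAddCommGroup X] [NormedSpace ℂ X] where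
  /-- the underlying homomorphism -/
  toHom : G →* (X →L[ℂ] X)
  /-- strong continuity -/
  continuous_apply : ∀ x : X, Continuous fun s : G => toHom s x

namespace StrongRep

/-- The representation is bounded: `sup_s ‖T(s)‖ < ∞`. -/
def IsBounded {G X : Type*} [Group G] [TopologicalSpace G]
    [NormedAddCommGroup X] [NormedSpace ℂ X] (T : StrongRep G X) : Prop :=
  ∃ M : ℝ, ∀ s : G, ‖T.toHom s‖ ≤ M

/-- The representation is by unitary operators on a Hilbert space. -/
def IsUnitary {G X : Type*} [Group G] [TopologicalSpace G]
    [NormedAddCommGroup X] [InnerProductSpace ℂ X] [CompleteSpace X]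
    (T : StrongRep G X) : Prop :=
  ∀ s : G, T.toHom s ∈ unitary (X →L[ℂ] X)

/-- Unitary representations are bounded. -/
theorem IsUnitary.isBounded {G X : Type*} [Group G] [TopologicalSpace G]
    [NormedAddCommGroup X] [InnerProductSpace ℂ X] [CompleteSpace X]
    {T : StrongRep G X} (hT : T.IsUnitary) : T.IsBounded := by
  refine ⟨1, fun s => ContinuousLinearMap.opNorm_le_bound _ zero_le_one fun x => ?_⟩
  rw [one_mul]
  exact (ContinuousLinearMap.norm_map_of_mem_unitary (hT s) x).le

end StrongRep

/-- A continuous function is strongly measurable on every set of finite measure, for a regular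
measure (no second countability is needed). -/
theorem aestronglyMeasurable_restrict_of_continuous {G X : Type*} [TopologicalSpace G]
    [R1Space G] [MeasurableSpace G] [BorelSpace G] [NormedAddCommGroup X]
    (μ : Measure G) [μ.Regular] {f : G → X} (hf : Continuous f)
    {s : Set G} (hs : MeasurableSet s) (hμs : μ s ≠ ⊤) :
    AEStronglyMeasurable f (μ.restrict s) := by
  choose K hKs hKco hKcl hKlt using fun n : ℕ =>
    hs.exists_isCompact_isClosed_sdiff_lt hμs (ε := ((n : ENNReal) + 1)⁻¹) (by simp)
  have hlim : Tendsto (fun n : ℕ => ((n : ENNReal) + 1)⁻¹) atTop (𝓝 0) := by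
    have := (tendsto_add_atTop_iff_nat 1).2 ENNReal.tendsto_inv_nat_nhds_zero
    simpa using this
  have hnull : μ (s \ ⋃ n, K n) = 0 := by
    refine le_antisymm (ge_of_tendsto' hlim fun n => ?_) zero_le
    exact (measure_mono (Set.sdiff_subset_sdiff_right (Set.subset_iUnion K n))).trans (hKlt n).le
  have heq : s =ᵐ[μ] ⋃ n, K n :=
    (ae_le_set.2 hnull).antisymm (Set.iUnion_subset hKs).eventuallyLE
  rw [Measure.restrict_congr_set heq, aestronglyMeasurable_iUnion_iff]
  exact fun n => hf.continuousOn.aestronglyMeasurable_of_isCompact (hKco n) (hKcl n).measurableSet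

/-- If `a ∈ L¹(G)` and `f` is continuous and bounded, then `a • f` is Bochner integrable. -/
theorem integrable_smul_of_continuous_bounded {G X : Type*} [TopologicalSpace G] [R1Space G]
    [MeasurableSpace G] [BorelSpace G]
    [NormedAddCommGroup X] [NormedSpace ℂ X] (μ : Measure G) [μ.Regular]
    {a : G → ℂ} (ha : Integrable a μ) (ham : StronglyMeasurable a)
    {f : G → X} (hf : Continuous f) {M : ℝ}
    (hM : ∀ s, ‖f s‖ ≤ M) : Integrable (fun s => a s • f s) μ := by
  have hmeas : AEStronglyMeasurable (fun s => a s • f s) μ := by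
    have hS : ∀ n : ℕ, MeasurableSet {s | ((n : ℝ) + 1)⁻¹ ≤ ‖a s‖} := fun n =>
      measurableSet_le measurable_const ham.norm.measurable
    have hU : AEStronglyMeasurable f
        (μ.restrict (⋃ n : ℕ, {s | ((n : ℝ) + 1)⁻¹ ≤ ‖a s‖})) := by
      rw [aestronglyMeasurable_iUnion_iff]
      exact fun n => aestronglyMeasurable_restrict_of_continuous μ hf (hS n)
        (ha.measure_norm_ge_lt_top (by positivity)).ne
    have hind := (aestronglyMeasurable_indicator_iff (MeasurableSet.iUnion hS)).2
      (ham.aestronglyMeasurable.smul hU)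
    refine hind.congr (Eventually.of_forall fun s => ?_)
    refine congrFun (Set.indicator_eq_self.2 fun t ht => ?_) s
    have hat : a t ≠ 0 := fun h => ht (by simp [h])
    obtain ⟨n, hn⟩ := exists_nat_one_div_lt (norm_pos_iff.2 hat)
    exact Set.mem_iUnion.2 ⟨n, by simpa using hn.le⟩
  refine (ha.norm.mul_const M).mono' hmeas (Eventually.of_forall fun s => ?_)
  rw [norm_smul]
  exact mul_le_mul_of_nonneg_left (hM s) (norm_nonneg _)

section L1

variable {G : Type*} [CommGroup G] [TopologicalSpace G] [MeasurableSpace G]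

/-- The Fourier transform `â(χ) = ∫ a(s) χ(s) dμ(s)` of `a ∈ L¹(G)` at a character `χ`. -/
def fourierL1 (μ : Measure G) (a : Lp ℂ 1 μ) (χ : PontryaginDual G) : ℂ :=
  ∫ s, a s * (χ s : ℂ) ∂μ

/-- `J_Λ`: those `a ∈ L¹(G)` whose Fourier transform vanishes in a neighbourhood of
each point of `Λ`. -/
def idealJ (μ : Measure G) (Λ : Set (PontryaginDual G)) : Set (Lp ℂ 1 μ) :=
  {a | ∀ χ ∈ Λ, ∀ᶠ ψ in 𝓝 χ, fourierL1 μ a ψ = 0}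

/-- `K_Λ`: those `a ∈ L¹(G)` whose Fourier transform vanishes on `Λ`. -/
def idealK (μ : Measure G) (Λ : Set (PontryaginDual G)) : Set (Lp ℂ 1 μ) :=
  {a | ∀ χ ∈ Λ, fourierL1 μ a χ = 0}

end L1

namespace StrongRep

variable {G : Type*} [CommGroup G] [TopologicalSpace G] [IsTopologicalGroup G]
  [MeasurableSpace G] [BorelSpace G]
  {X : Type*} [NormedAddCommGroup X] [NormedSpace ℂ X]

/-- The integrand `a(s) T(s) x` defining `â(T) x` is Bochner integrable. -/
theorem integrable_smul_apply (μ : Measure G) [μ.Regular] (T : StrongRep G X)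
    (hT : T.IsBounded) (a : Lp ℂ 1 μ) (x : X) :
    Integrable (fun s => a s • T.toHom s x) μ := by
  obtain ⟨M, hM⟩ := hT
  exact integrable_smul_of_continuous_bounded μ (L1.integrable_coeFn a)
    (Lp.stronglyMeasurable a) (T.continuous_apply x)
    fun s => (T.toHom s).le_of_opNorm_le (hM s) x

/-- The bounded operator `â(T)` given by `â(T) x = ∫ a(s) T(s) x dμ(s)`. -/
def hatOp (μ : Measure G) [μ.Regular] (T : StrongRep G X)
    (hT : T.IsBounded) (a : Lp ℂ 1 μ) : X →L[ℂ] X :=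
  LinearMap.mkContinuousOfExistsBound
    { toFun := fun x => ∫ s, a s • T.toHom s x ∂μ
      map_add' := fun x y => by
        simp only [map_add, smul_add]
        exact integral_add (T.integrable_smul_apply μ hT a x) (T.integrable_smul_apply μ hT a y)
      map_smul' := fun c x => by
        simp only [map_smul, RingHom.id_apply]
        rw [← integral_smul]
        exact integral_congr_ae (Eventually.of_forall fun s => smul_comm _ _ _) }
    (by
      obtain ⟨M, hM⟩ := hT
      refine ⟨∫ s, ‖a s‖ * M ∂μ, fun x => ?_⟩
      rw [← integral_mul_const]
      refine norm_integral_le_of_norm_le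
        (((L1.integrable_coeFn a).norm.mul_const M).mul_const _)
        (Eventually.of_forall fun s => ?_)
      rw [norm_smul, mul_assoc]
      exact mul_le_mul_of_nonneg_left ((T.toHom s).le_of_opNorm_le (hM s) x) (norm_nonneg _))

theorem hatOp_apply (μ : Measure G) [μ.Regular] (T : StrongRep G X)
    (hT : T.IsBounded) (a : Lp ℂ 1 μ) (x : X) :
    T.hatOp μ hT a x = ∫ s, a s • T.toHom s x ∂μ := rfl

/-- The spectral subspace `M_T(Λ) = ⋂_{a ∈ J_Λ} ker â(T)`. -/
def spectralSubspace (μ : Measure G) [μ.Regular] (T : StrongRep G X)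
    (hT : T.IsBounded) (Λ : Set (PontryaginDual G)) : Submodule ℂ X :=
  ⨅ a ∈ idealJ μ Λ, LinearMap.ker (T.hatOp μ hT a : X →ₗ[ℂ] X)

/-- The (Arveson) spectrum `Sp(T)`: the intersection of all closed `Λ` with `M_T(Λ) = X`. -/
def arvesonSpectrum (μ : Measure G) [μ.Regular] (T : StrongRep G X)
    (hT : T.IsBounded) : Set (PontryaginDual G) :=
  ⋂₀ {Λ | IsClosed Λ ∧ T.spectralSubspace μ hT Λ = ⊤}

end StrongRep

end

/-!
The von Neumann algebra `A` generated by the operators `T(s)` is a commutative C⋆-algebra containing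
every `â(T)`. Translation is continuous on `L¹(G)`, so `s ↦ T(s) â(T)` is norm continuous, and a
Gelfand character `φ` of `A` with `φ (â(T)) ≠ 0` for some `a` restricts to a continuous character
`s ↦ φ (T(s))` of `G`, at which the Fourier transform of `b` takes the value `φ (b̂(T))`. Since the
Gelfand transform is isometric, `‖â(T)‖` is the supremum of `|â|` over the characters of `G`
obtained this way, and it is attained if `â(T) ≠ 0`.

It remains to see that these characters form a dense subset of `Sp(T)`. Their closure contains
`Sp(T)` because an operator `b̂(T)` with `b̂ = 0` on all of them is zero. They belong to `Sp(T)`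
by the regularity of `L¹(G)`, which comes from the same construction applied to the regular
representation: Urysohn's lemma on the Gelfand space gives a nonzero `f ∈ L²(G)` whose spectrum
lies in a prescribed small open set `V`. Multiplication by a character translates spectra in the
dual group, so the Fourier transform `ψ ↦ ⟨f, ψ f⟩` of `|f|² ∈ L¹(G)` is nonzero at `1` and
vanishes unless `ψ V` meets `V`. Multiplying `|f|²` by a character moves this peak to any given
point.
-/

noncomputable section

theorem exists_isCompact_setLIntegral_compl_lt {α : Type*} [TopologicalSpace α] [R1Space α]
    [MeasurableSpace α] [BorelSpace α] {μ : Measure α} [μ.InnerRegularCompactLTTop]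
    {f : α → ENNReal} (hf : ∫⁻ x, f x ∂μ ≠ ⊤) {ε : ENNReal} (hε : ε ≠ 0) :
    ∃ K, IsCompact K ∧ IsClosed K ∧ ∫⁻ x in Kᶜ, f x ∂μ < ε := by
  have hε2 : ε / 2 ≠ 0 := (ENNReal.half_pos hε).ne'
  obtain ⟨s, hs, hμs, hsε⟩ := exists_setLIntegral_compl_lt hf hε2
  obtain ⟨δ, hδ, hδε⟩ := exists_pos_setLIntegral_lt_of_measure_lt hf hε2
  obtain ⟨K, -, hK, hKc, hKδ⟩ := hs.exists_isCompact_isClosed_sdiff_lt hμs.ne hδ.ne'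
  refine ⟨K, hK, hKc, ?_⟩
  calc ∫⁻ x in Kᶜ, f x ∂μ ≤ ∫⁻ x in sᶜ ∪ s \ K, f x ∂μ :=
        lintegral_mono_set fun x hx => (em (x ∈ s)).elim (fun h => .inr ⟨h, hx⟩) .inl
    _ ≤ ∫⁻ x in sᶜ, f x ∂μ + ∫⁻ x in s \ K, f x ∂μ := lintegral_union_le _ _ _
    _ < ε / 2 + ε / 2 := ENNReal.add_lt_add hsε (hδε _ hKδ)
    _ = ε := ENNReal.add_halves ε

section Fourier

variable {G : Type*} [CommGroup G] [TopologicalSpace G]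

theorem continuous_coe_pontryaginDual (χ : PontryaginDual G) :
    Continuous fun s => (χ s : ℂ) :=
  continuous_subtype_val.comp (map_continuous χ)

theorem continuous_coe_pontryaginDual_uncurry [LocallyCompactSpace G] :
    Continuous fun p : PontryaginDual G × G => (p.1 p.2 : ℂ) :=
  continuous_subtype_val.comp (ContinuousMonoidHom.instContinuousEval G Circle).continuous_eval

variable [MeasurableSpace G] [BorelSpace G] {μ : Measure G} {f : G → ℂ}

theorem integrable_mul_pontryaginDual (hf : Integrable f μ) (χ : PontryaginDual G) :
    Integrable (fun s => f s * (χ s : ℂ)) μ :=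
  hf.mul_bdd (c := 1) (continuous_coe_pontryaginDual χ).aestronglyMeasurable
    (.of_forall fun s => (Circle.norm_coe (χ s)).le)

variable [LocallyCompactSpace G] [R1Space G]

theorem continuous_setIntegral_mul_pontryaginDual {K : Set G} (hK : IsCompact K)
    (hKm : MeasurableSet K) (hf : IntegrableOn f K μ) :
    Continuous fun χ : PontryaginDual G => ∫ s in K, f s * (χ s : ℂ) ∂μ := by
  obtain ⟨η, hη1, -, hηc, -⟩ := exists_continuous_one_zero_of_isCompact hK isClosed_empty
    (Set.disjoint_empty K)
  have hcont := continuousOn_integral_bilinear_of_locally_integrable_of_compact_support (μ := μ)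
    (ContinuousLinearMap.mul ℂ ℂ) (f := fun (χ : PontryaginDual G) s => (η s : ℂ) * (χ s : ℂ))
    (s := Set.univ) (g := K.indicator f) hηc.isCompact
    (((Complex.continuous_ofReal.comp ((map_continuous η).comp continuous_snd)).mul
      continuous_coe_pontryaginDual_uncurry).continuousOn)
    (fun χ s _ hs => by rw [image_eq_zero_of_notMem_tsupport hs, Complex.ofReal_zero, zero_mul])
    ((integrable_indicator_iff hKm).2 hf).integrableOn
  refine (continuousOn_univ.1 hcont).congr fun χ => ?_
  rw [← integral_indicator hKm]
  refine integral_congr_ae (.of_forall fun s => ?_)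
  by_cases hs : s ∈ K
  · simp [hs, hη1 hs]
  · simp [hs]

theorem continuous_integral_mul_pontryaginDual [μ.InnerRegularCompactLTTop]
    (hf : Integrable f μ) :
    Continuous fun χ : PontryaginDual G => ∫ s, f s * (χ s : ℂ) ∂μ := by
  refine continuous_of_uniform_approx_of_continuous fun u hu => ?_
  obtain ⟨ε, hε, hεu⟩ := mem_uniformity_edist.1 hu
  obtain ⟨K, hK, hKc, hKε⟩ := exists_isCompact_setLIntegral_compl_lt hf.2.ne hε.ne'
  refine ⟨_, continuous_setIntegral_mul_pontryaginDual hK hKc.measurableSet hf.integrableOn,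
    fun χ => hεu ?_⟩
  rw [edist_eq_enorm_sub,
    ← setIntegral_compl hKc.measurableSet (integrable_mul_pontryaginDual hf χ)]
  refine (enorm_integral_le_lintegral_enorm _).trans_lt (lt_of_eq_of_lt ?_ hKε)
  refine lintegral_congr fun s => ?_
  rw [enorm_mul, ← enorm_norm (χ s : ℂ), Circle.norm_coe, enorm_one, mul_one]

theorem continuous_fourierL1 [μ.InnerRegularCompactLTTop] (a : Lp ℂ 1 μ) :
    Continuous (fourierL1 μ a) :=
  continuous_integral_mul_pontryaginDual (L1.integrable_coeFn a)

end Fourier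

namespace StrongRep

section HatOp

variable {G : Type*} [CommGroup G] [TopologicalSpace G] [IsTopologicalGroup G]
  [MeasurableSpace G] [BorelSpace G] (μ : Measure G) [μ.Regular]
  {X : Type*} [NormedAddCommGroup X] [NormedSpace ℂ X] {T : StrongRep G X} (hT : T.IsBounded)

theorem hatOp_sub (a b : Lp ℂ 1 μ) :
    T.hatOp μ hT (a - b) = T.hatOp μ hT a - T.hatOp μ hT b := by
  ext x
  rw [sub_apply, hatOp_apply, hatOp_apply, hatOp_apply,
    ← integral_sub (T.integrable_smul_apply μ hT a x) (T.integrable_smul_apply μ hT b x)]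
  refine integral_congr_ae ((Lp.coeFn_sub a b).mono fun s hs => ?_)
  simp only [hs, Pi.sub_apply, sub_smul]

theorem norm_hatOp_le {M : ℝ} (hM : ∀ s, ‖T.toHom s‖ ≤ M) (a : Lp ℂ 1 μ) :
    ‖T.hatOp μ hT a‖ ≤ ‖a‖ * M := by
  have hM0 : 0 ≤ M := (norm_nonneg _).trans (hM 1)
  refine ContinuousLinearMap.opNorm_le_bound _ (by positivity) fun x => ?_
  rw [hatOp_apply, L1.norm_eq_integral_norm, mul_assoc, ← integral_mul_const]
  refine norm_integral_le_of_norm_le ((L1.integrable_coeFn a).norm.mul_const _)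
    (.of_forall fun s => ?_)
  rw [norm_smul]
  gcongr
  exact (T.toHom s).le_of_opNorm_le (hM s) x

theorem continuous_hatOp : Continuous fun a : Lp ℂ 1 μ => T.hatOp μ hT a := by
  obtain ⟨M, hM⟩ := id hT
  refine (LipschitzWith.of_dist_le' (K := M) fun a b => ?_).continuous
  rw [dist_eq_norm, dist_eq_norm, ← hatOp_sub, mul_comm]
  exact norm_hatOp_le μ hT hM _

theorem commute_hatOp [CompleteSpace X] (a : Lp ℂ 1 μ) {y : X →L[ℂ] X}
    (hy : ∀ s, Commute y (T.toHom s)) : Commute y (T.hatOp μ hT a) := by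
  ext x
  rw [mul_apply_eq_comp, mul_apply_eq_comp, hatOp_apply, hatOp_apply,
    ← ContinuousLinearMap.integral_comp_comm _ (T.integrable_smul_apply μ hT a x)]
  refine integral_congr_ae (.of_forall fun s => ?_)
  change y (a s • T.toHom s x) = a s • T.toHom s (y x)
  rw [map_smul]
  exact congrArg _ (DFunLike.congr_fun (hy s).eq x)

theorem hatOp_mul_eq_integral [CompleteSpace X] (b : Lp ℂ 1 μ) {R : X →L[ℂ] X}
    (hR : Continuous fun s => T.toHom s * R) :
    T.hatOp μ hT b * R = ∫ s, b s • (T.toHom s * R) ∂μ := by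
  obtain ⟨M, hM⟩ := id hT
  have hint : Integrable (fun s => b s • (T.toHom s * R)) μ :=
    integrable_smul_of_continuous_bounded μ (L1.integrable_coeFn b) (Lp.stronglyMeasurable b) hR
      fun s => (norm_mul_le _ _).trans (mul_le_mul_of_nonneg_right (hM s) (norm_nonneg R))
  ext x
  exact (ContinuousLinearMap.apply ℂ X x).integral_comp_comm hint

open DomMulAct in
theorem toHom_mul_hatOp [CompleteSpace X] [μ.IsMulLeftInvariant] (a : Lp ℂ 1 μ) (s : G) :
    T.toHom s * T.hatOp μ hT a = T.hatOp μ hT (DomMulAct.mk s⁻¹ • a) := by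
  ext x
  rw [mul_apply_eq_comp, hatOp_apply, hatOp_apply,
    ← ContinuousLinearMap.integral_comp_comm _ (T.integrable_smul_apply μ hT a x),
    ← integral_mul_left_eq_self _ s⁻¹]
  refine integral_congr_ae ((smul_Lp_ae_eq (DomMulAct.mk s⁻¹) a).mono fun t ht => ?_)
  simp only [ht, Equiv.symm_apply_apply, smul_eq_mul, map_smul]
  rw [← mul_apply_eq_comp, ← map_mul, mul_inv_cancel_left]

theorem continuous_toHom_mul_hatOp [CompleteSpace X] [LocallyCompactSpace G]
    [μ.IsMulLeftInvariant] (a : Lp ℂ 1 μ) : Continuous fun s => T.toHom s * T.hatOp μ hT a := by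
  simp_rw [toHom_mul_hatOp]
  have : Fact ((1 : ENNReal) ≠ ⊤) := ⟨ENNReal.one_ne_top⟩
  have hmk : Continuous fun s : G => DomMulAct.mk s⁻¹ :=
    DomMulAct.continuous_mk.comp continuous_inv
  exact (continuous_hatOp μ hT).comp (hmk.smul continuous_const)

theorem hatOp_indicatorConstLp_apply {S : Set G} (hS : MeasurableSet S) (hμS : μ S ≠ ⊤) (c : ℂ)
    (x : X) : T.hatOp μ hT (indicatorConstLp 1 hS hμS c) x = c • ∫ s in S, T.toHom s x ∂μ := by
  rw [hatOp_apply, ← integral_smul, ← integral_indicator hS]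
  have hind := indicatorConstLp_coeFn (p := 1) (hs := hS) (hμs := hμS) (c := c)
  refine integral_congr_ae (hind.mono fun s hs => ?_)
  by_cases hsS : s ∈ S <;> simp [hs, hsS]

theorem exists_hatOp_ne_zero [LocallyCompactSpace G] [CompleteSpace X] [Nontrivial X]
    [μ.IsOpenPosMeasure] : ∃ a, T.hatOp μ hT a ≠ 0 := by
  by_contra! h
  obtain ⟨M, hM⟩ := id hT
  obtain ⟨x, hx⟩ := exists_ne (0 : X)
  obtain ⟨U, hU1, hU, hμU⟩ := μ.exists_isOpen_measure_lt_top (1 : G)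
  have hint : IntegrableOn (fun s => T.toHom s x) U μ :=
    .of_bound hμU (aestronglyMeasurable_restrict_of_continuous μ (T.continuous_apply x)
      hU.measurableSet hμU.ne) (M * ‖x‖) (.of_forall fun s => (T.toHom s).le_of_opNorm_le (hM s) x)
  have hae : ∀ᵐ s ∂μ.restrict U, T.toHom s x = 0 :=
    hint.ae_eq_zero_of_forall_setIntegral_eq_zero fun S hS _ => by
      rw [Measure.restrict_restrict hS, ← one_smul ℂ (∫ s in S ∩ U, _ ∂μ),
        ← hatOp_indicatorConstLp_apply μ hT (hS.inter hU.measurableSet)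
          (measure_inter_lt_top_of_right_ne_top hμU.ne).ne, h, zero_apply]
  have : NeBot (ae (μ.restrict U)) :=
    ae_restrict_neBot.2 (hU.measure_pos μ ⟨1, hU1⟩).ne'
  obtain ⟨s, hs⟩ := hae.exists
  refine hx ?_
  have h1 := congrArg (T.toHom s⁻¹) hs
  rwa [← mul_apply_eq_comp, ← map_mul, inv_mul_cancel, map_one, one_apply_eq_self, map_zero] at h1

theorem spectralSubspace_eq_top_iff {Λ : Set (PontryaginDual G)} :
    T.spectralSubspace μ hT Λ = ⊤ ↔ ∀ b ∈ idealJ μ Λ, T.hatOp μ hT b = 0 := by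
  simp only [spectralSubspace, iInf_eq_top, LinearMap.ker_eq_top]
  exact forall₂_congr fun b _ =>
    ⟨fun h => ContinuousLinearMap.coe_injective h, fun h => by rw [h]; rfl⟩

end HatOp
end StrongRep

section InducedCharacter

open WeakDual

variable {A : Type*} [CommCStarAlgebra A]

theorem exists_norm_character_eq [Nontrivial A] (a : A) :
    ∃ φ : characterSpace ℂ A, ‖φ a‖ = ‖a‖ := by
  obtain ⟨z, hz, hza⟩ := spectrum.exists_nnnorm_eq_spectralRadius a
  obtain ⟨φ, rfl⟩ := CharacterSpace.mem_spectrum_iff_exists.1 hz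
  rw [IsStarNormal.spectralRadius_eq_nnnorm] at hza
  exact ⟨φ, congrArg NNReal.toReal (ENNReal.coe_injective hza)⟩

theorem eq_zero_of_forall_character_eq_zero {a : A} (h : ∀ φ : characterSpace ℂ A, φ a = 0) :
    a = 0 := by
  nontriviality A
  obtain ⟨φ, hφ⟩ := exists_norm_character_eq a
  rwa [h φ, norm_zero, eq_comm, norm_eq_zero] at hφ

theorem exists_character_eq_one_of_isOpen {O : Set (characterSpace ℂ A)} (hO : IsOpen O)
    {φ₀ : characterSpace ℂ A} (hφ₀ : φ₀ ∈ O) :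
    ∃ m : A, φ₀ m = 1 ∧ ∀ φ : characterSpace ℂ A, φ ∉ O → φ m = 0 := by
  obtain ⟨f, hf0, hf1, -⟩ := exists_continuous_zero_one_of_isClosed hO.isClosed_compl
    (isClosed_singleton (x := φ₀)) (Set.disjoint_singleton_right.2 fun h => h hφ₀)
  obtain ⟨m, hm⟩ := (gelfandTransform_bijective A).2 ⟨fun φ => (f φ : ℂ), by fun_prop⟩
  have hmf (φ : characterSpace ℂ A) : φ m = f φ := DFunLike.congr_fun hm φ
  refine ⟨m, ?_, fun φ hφ => ?_⟩
  · rw [hmf, hf1 rfl, Pi.one_apply, Complex.ofReal_one]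
  · rw [hmf, hf0 hφ, Pi.zero_apply, Complex.ofReal_zero]

variable {G : Type*} [Monoid G] [TopologicalSpace G] (u : G →* unitary A)

/-- The Gelfand characters of `A` which do not vanish on all the elements `a` for which
`s ↦ u s * a` is norm continuous. This is what makes `s ↦ φ (u s)` a continuous character of `G`
although `u` itself need not be norm continuous. -/
def nondegenerateCharacters : Set (characterSpace ℂ A) :=
  {φ | ∃ a : A, Continuous (fun s => (u s : A) * a) ∧ φ a ≠ 0}

variable {u}

theorem isOpen_character_ne_zero (a : A) : IsOpen {φ : characterSpace ℂ A | φ a ≠ 0} :=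
  isOpen_ne_fun (map_continuous (gelfandTransform ℂ A a)) continuous_const

theorem isOpen_nondegenerateCharacters : IsOpen (nondegenerateCharacters u) := by
  have : nondegenerateCharacters u = ⋃ a ∈ {a : A | Continuous fun s => (u s : A) * a},
      {φ | φ a ≠ 0} := by ext; simp [nondegenerateCharacters]
  rw [this]
  exact isOpen_biUnion fun a _ => isOpen_character_ne_zero a

theorem norm_character_unitary (φ : characterSpace ℂ A) (v : unitary A) : ‖φ (v : A)‖ = 1 :=
  CStarRing.norm_of_mem_unitary (Unitary.map_mem φ v.2)

theorem continuous_character_comp {φ : characterSpace ℂ A} (hφ : φ ∈ nondegenerateCharacters u) :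
    Continuous fun s => φ (u s : A) := by
  obtain ⟨a, ha, hφa⟩ := hφ
  refine (((map_continuous φ).comp ha).div_const (φ a)).congr fun s => ?_
  rw [Function.comp_apply, map_mul, mul_div_cancel_right₀ _ hφa]

variable (u) in
/-- The continuous character `s ↦ φ (u s)` of `G` induced by a nondegenerate Gelfand character `φ`
of `A`. -/
def inducedCharacter (φ : nondegenerateCharacters u) : PontryaginDual G where
  toFun s := ⟨φ.1 (u s), mem_sphere_zero_iff_norm.2 (norm_character_unitary φ.1 (u s))⟩
  map_one' := Circle.ext (by simp)
  map_mul' s t := Circle.ext (by rw [map_mul]; exact map_mul φ.1 _ _)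
  continuous_toFun := (continuous_character_comp φ.2).subtype_mk _

theorem coe_inducedCharacter_apply (φ : nondegenerateCharacters u) (s : G) :
    (inducedCharacter u φ s : ℂ) = φ.1 (u s : A) := rfl

theorem continuous_inducedCharacter : Continuous (inducedCharacter u) := by
  refine ContinuousMonoidHom.continuous_of_continuous_uncurry
    (inducedCharacter u : _ → (G →ₜ* Circle)) (Topology.IsInducing.subtypeVal.continuous_iff.2 ?_)
  refine continuous_iff_continuousAt.2 fun ⟨φ₀, s₀⟩ => ?_
  obtain ⟨a, ha, hφ₀⟩ := φ₀.2
  have hden : Continuous fun p : nondegenerateCharacters u × G => p.1.1 a :=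
    (map_continuous (gelfandTransform ℂ A a)).comp (continuous_subtype_val.comp continuous_fst)
  have hnum : Continuous fun p : nondegenerateCharacters u × G => p.1.1 ((u p.2 : A) * a) :=
    ((gelfandTransform_isometry A).continuous.comp (ha.comp continuous_snd)).eval
      (continuous_subtype_val.comp continuous_fst)
  refine (hnum.continuousAt.div hden.continuousAt hφ₀).congr ?_
  filter_upwards [hden.continuousAt.eventually_ne hφ₀] with p hp
  rw [Pi.div_apply, map_mul, mul_div_cancel_right₀ _ hp]
  rfl

/-- `m` is a bump function supported in `V`, and `σ` translates supports by `χ`. -/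
theorem exists_ne_zero_star_mul_eq_zero {V : Set (PontryaginDual G)} (hV : IsOpen V)
    {φ₀ : nondegenerateCharacters u} (hφ₀ : inducedCharacter u φ₀ ∈ V) :
    ∃ m : A, m ≠ 0 ∧ ∀ (σ : A →⋆ₐ[ℂ] A) (χ : PontryaginDual G),
      (∀ s, σ (u s) = (χ s : ℂ) • (u s : A)) → (∀ ψ ∈ V, χ * ψ ∉ V) → star (σ m) * m = 0 := by
  obtain ⟨m, hm₀, hm⟩ := exists_character_eq_one_of_isOpen
    (isOpen_nondegenerateCharacters.isOpenMap_subtype_val _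
      (hV.preimage continuous_inducedCharacter)) ⟨φ₀, hφ₀, rfl⟩
  refine ⟨m, fun h => one_ne_zero (α := ℂ) ?_, fun σ χ hσ hχ =>
    eq_zero_of_forall_character_eq_zero fun φ => ?_⟩
  · rw [← hm₀, h, map_zero]
  by_contra h
  rw [map_mul, map_star, mul_eq_zero, star_eq_zero, not_or] at h
  obtain ⟨φ, hφ, rfl⟩ := not_imp_comm.1 (hm φ) h.2
  obtain ⟨φ', hφ', hφσ⟩ := not_imp_comm.1 (hm (CharacterSpace.compContinuousMap σ φ)) h.1
  have hmul : χ * inducedCharacter u φ = inducedCharacter u φ' :=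
    PontryaginDual.ext fun s => Circle.ext <| by
      calc ((χ s * inducedCharacter u φ s : Circle) : ℂ) = φ.1 (σ (u s)) := by
            rw [hσ, map_smul, Circle.coe_mul, coe_inducedCharacter_apply, smul_eq_mul]
        _ = φ'.1 (u s) := by rw [hφσ]; rfl
  exact hχ _ hφ (hmul ▸ hφ')

end InducedCharacter

namespace StrongRep.IsUnitary

open WeakDual

section Bicommutant

variable {G : Type*} [Group G] [TopologicalSpace G]
  {X : Type*} [NormedAddCommGroup X] [InnerProductSpace ℂ X] [CompleteSpace X]
  {T : StrongRep G X} (hT : T.IsUnitary)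

include hT in
theorem star_toHom (s : G) : star (T.toHom s) = T.toHom s⁻¹ :=
  left_inv_eq_right_inv (Unitary.mem_iff.1 (hT s)).1
    (by rw [← map_mul, mul_inv_cancel, map_one])

/-- The von Neumann algebra generated by the operators `T(s)`, as the bicommutant of their range.
It is the commutative C⋆-algebra (for abelian `G`) whose Gelfand characters yield the spectrum
of `T`. Unitarity enters the definition only to make it stable under adjoints. -/
def bicommutant : StarSubalgebra ℂ (X →L[ℂ] X) where
  toSubalgebra := Subalgebra.centralizer ℂ (Set.centralizer (Set.range T.toHom))
  star_mem' := Set.star_mem_centralizer' fun _ => Set.star_mem_centralizer' <| by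
    rintro _ ⟨s, rfl⟩
    exact ⟨s⁻¹, (hT.star_toHom s).symm⟩

variable {hT}

theorem mem_bicommutant_iff {z : X →L[ℂ] X} :
    z ∈ hT.bicommutant ↔ ∀ y, (∀ s, Commute y (T.toHom s)) → Commute y z := by
  change z ∈ Set.centralizer _ ↔ _
  simp only [Set.mem_centralizer_iff, Set.forall_mem_range, commute_iff_eq, eq_comm]

theorem toHom_mem_bicommutant (s : G) : T.toHom s ∈ hT.bicommutant :=
  mem_bicommutant_iff.2 fun _ hy => hy s

theorem isClosed_bicommutant : IsClosed (hT.bicommutant : Set (X →L[ℂ] X)) :=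
  Set.isClosed_centralizer _

theorem map_mem_bicommutant {e : (X →L[ℂ] X) ≃⋆ₐ[ℂ] (X →L[ℂ] X)} {c : G → ℂ}
    (he : ∀ s, e (T.toHom s) = c s • T.toHom s) {z : X →L[ℂ] X} (hz : z ∈ hT.bicommutant) :
    e z ∈ hT.bicommutant := by
  refine mem_bicommutant_iff.2 fun y hy => ?_
  have hsymm (s : G) : Commute (e.symm y) (T.toHom s) := by
    refine Commute.of_map (f := e) e.injective ?_
    rw [e.apply_symm_apply, he]
    exact (hy s).smul_right (c s)
  simpa only [e.apply_symm_apply] using (mem_bicommutant_iff.1 hz _ hsymm).map e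

variable (hT)

/-- The operators `T(s)` as unitary elements of the bicommutant. -/
def op : G →* unitary hT.bicommutant where
  toFun s := ⟨⟨T.toHom s, toHom_mem_bicommutant s⟩,
    Unitary.mem_iff.2 ⟨Subtype.ext (Unitary.mem_iff.1 (hT s)).1,
      Subtype.ext (Unitary.mem_iff.1 (hT s)).2⟩⟩
  map_one' := Subtype.ext (Subtype.ext (map_one T.toHom))
  map_mul' s t := Subtype.ext (Subtype.ext (map_mul T.toHom s t))

end Bicommutant

section CommGroup

variable {G : Type*} [CommGroup G] [TopologicalSpace G]
  {X : Type*} [NormedAddCommGroup X] [InnerProductSpace ℂ X] [CompleteSpace X]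
  {T : StrongRep G X} (hT : T.IsUnitary)

instance : CommCStarAlgebra hT.bicommutant where
  __ := StarSubalgebra.cstarAlgebra hT.bicommutant (h_closed := isClosed_bicommutant)
  mul_comm y z := Subtype.ext <| mem_bicommutant_iff.1 z.2 y fun s =>
    (mem_bicommutant_iff.1 y.2 _ fun t => ((Commute.all s t).map T.toHom)).symm

/-- The characters of `G` induced by the nondegenerate Gelfand characters of the bicommutant. -/
def gelfandSpectrum : Set (PontryaginDual G) :=
  Set.range (inducedCharacter hT.op)

/-- `x` is a vector with spectrum in `V`, and `U` translates spectra by `χ`. -/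
theorem exists_ne_zero_inner_eq_zero {V : Set (PontryaginDual G)} (hV : IsOpen V)
    (hVT : (hT.gelfandSpectrum ∩ V).Nonempty) :
    ∃ x : X, x ≠ 0 ∧ ∀ (U : unitary (X →L[ℂ] X)) (χ : PontryaginDual G),
      (∀ s, star (U : X →L[ℂ] X) * T.toHom s * U = (χ s : ℂ) • T.toHom s) →
      (∀ ψ ∈ V, χ * ψ ∉ V) → inner ℂ x ((U : X →L[ℂ] X) x) = 0 := by
  obtain ⟨_, ⟨φ, rfl⟩, hφ⟩ := hVT
  obtain ⟨m, hm0, hm⟩ := exists_ne_zero_star_mul_eq_zero hV hφ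
  obtain ⟨x, hx⟩ : ∃ x, (m : X →L[ℂ] X) x ≠ 0 := by
    by_contra! h
    exact hm0 (Subtype.ext (ContinuousLinearMap.ext h))
  refine ⟨(m : X →L[ℂ] X) x, hx, fun U χ hU hχ => ?_⟩
  let e := Unitary.conjStarAlgAut ℂ (X →L[ℂ] X) (star U)
  have he (z : X →L[ℂ] X) : e z = star (U : X →L[ℂ] X) * z * U :=
    Unitary.conjStarAlgAut_star_apply U z
  let σ : hT.bicommutant →⋆ₐ[ℂ] hT.bicommutant :=
    ((e : (X →L[ℂ] X) →⋆ₐ[ℂ] (X →L[ℂ] X)).comp hT.bicommutant.subtype).codRestrict _ fun z =>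
      map_mem_bicommutant (c := fun s => (χ s : ℂ)) (fun s => (he _).trans (hU s)) z.2
  have hzero : star (e m) * (m : X →L[ℂ] X) = 0 :=
    congrArg Subtype.val (hm σ χ (fun s => Subtype.ext ((he _).trans (hU s))) hχ)
  have hmUm : star (m : X →L[ℂ] X) * U * m = 0 := by
    calc star (m : X →L[ℂ] X) * U * m = U * (star (e m) * m) := by
          rw [he, star_mul, star_mul, star_star]
          simp only [← mul_assoc, Unitary.mul_star_self_of_mem U.2, one_mul]
      _ = 0 := by rw [hzero, mul_zero]
  rw [← ContinuousLinearMap.adjoint_inner_right, ← ContinuousLinearMap.star_eq_adjoint,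
    ← mul_apply_eq_comp, ← mul_apply_eq_comp, hmUm, zero_apply, inner_zero_right]

end CommGroup

section Hat

variable {G : Type*} [CommGroup G] [TopologicalSpace G] [IsTopologicalGroup G]
  [MeasurableSpace G] [BorelSpace G] (μ : Measure G) [μ.Regular]
  {X : Type*} [NormedAddCommGroup X] [InnerProductSpace ℂ X] [CompleteSpace X]
  {T : StrongRep G X} (hT : T.IsUnitary)

/-- The operator `â(T)` as an element of the bicommutant. -/
def hat (a : Lp ℂ 1 μ) : hT.bicommutant :=
  ⟨T.hatOp μ hT.isBounded a, mem_bicommutant_iff.2 fun _ hy => commute_hatOp μ hT.isBounded a hy⟩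

theorem norm_hat (a : Lp ℂ 1 μ) : ‖hT.hat μ a‖ = ‖T.hatOp μ hT.isBounded a‖ := rfl

theorem integrable_smul_op_mul (b : Lp ℂ 1 μ) {a : hT.bicommutant}
    (ha : Continuous fun s => (hT.op s : hT.bicommutant) * a) :
    Integrable (fun s => b s • ((hT.op s : hT.bicommutant) * a)) μ :=
  integrable_smul_of_continuous_bounded μ (L1.integrable_coeFn b) (Lp.stronglyMeasurable b) ha
    fun s => (CStarRing.norm_coe_unitary_mul (hT.op s) a).le

theorem hat_mul_eq_integral (b : Lp ℂ 1 μ) {a : hT.bicommutant}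
    (ha : Continuous fun s => (hT.op s : hT.bicommutant) * a) :
    hT.hat μ b * a = ∫ s, b s • ((hT.op s : hT.bicommutant) * a) ∂μ := by
  let ι : hT.bicommutant →L[ℂ] (X →L[ℂ] X) :=
    ⟨hT.bicommutant.subtype.toAlgHom.toLinearMap, continuous_subtype_val⟩
  exact Subtype.ext <|
    (hatOp_mul_eq_integral μ hT.isBounded b (continuous_subtype_val.comp ha)).trans
      (ι.integral_comp_comm (integrable_smul_op_mul μ hT b ha))

theorem character_hat (φ : nondegenerateCharacters hT.op) (b : Lp ℂ 1 μ) :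
    φ.1 (hT.hat μ b) = fourierL1 μ b (inducedCharacter hT.op φ) := by
  obtain ⟨a, ha, hφa⟩ := φ.2
  refine mul_right_cancel₀ hφa ?_
  calc φ.1 (hT.hat μ b) * φ.1 a
      = CharacterSpace.toCLM φ.1 (∫ s, b s • ((hT.op s : hT.bicommutant) * a) ∂μ) := by
        rw [← map_mul, hat_mul_eq_integral μ hT b ha, CharacterSpace.coe_toCLM]
    _ = ∫ s, b s * (inducedCharacter hT.op φ s : ℂ) * φ.1 a ∂μ := by
        rw [← ContinuousLinearMap.integral_comp_comm _ (integrable_smul_op_mul μ hT b ha)]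
        simp only [CharacterSpace.coe_toCLM, map_smul, map_mul, smul_eq_mul, mul_assoc,
          coe_inducedCharacter_apply]
    _ = fourierL1 μ b (inducedCharacter hT.op φ) * φ.1 a := integral_mul_const _ _

theorem norm_fourierL1_le (a : Lp ℂ 1 μ) {χ : PontryaginDual G} (hχ : χ ∈ hT.gelfandSpectrum) :
    ‖fourierL1 μ a χ‖ ≤ ‖T.hatOp μ hT.isBounded a‖ := by
  obtain ⟨φ, rfl⟩ := hχ
  rw [← character_hat, ← norm_hat]
  exact NonUnitalStarAlgHom.norm_apply_le φ.1 _

variable [LocallyCompactSpace G] [μ.IsMulLeftInvariant]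

theorem continuous_op_mul_hat (a : Lp ℂ 1 μ) :
    Continuous fun s => (hT.op s : hT.bicommutant) * hT.hat μ a :=
  (continuous_toHom_mul_hatOp μ hT.isBounded a).subtype_mk _

theorem exists_norm_fourierL1_eq {a : Lp ℂ 1 μ} (ha : T.hatOp μ hT.isBounded a ≠ 0) :
    ∃ χ ∈ hT.gelfandSpectrum, ‖fourierL1 μ a χ‖ = ‖T.hatOp μ hT.isBounded a‖ := by
  have : Nontrivial hT.bicommutant := ⟨hT.hat μ a, 0, fun h => ha (congrArg Subtype.val h)⟩
  obtain ⟨φ, hφ⟩ := exists_norm_character_eq (hT.hat μ a)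
  have hφa : φ (hT.hat μ a) ≠ 0 := by rwa [← norm_ne_zero_iff, hφ, norm_hat, norm_ne_zero_iff]
  refine ⟨_, ⟨⟨φ, _, continuous_op_mul_hat μ hT a, hφa⟩, rfl⟩, ?_⟩
  rw [← character_hat, hφ, norm_hat]

end Hat

end StrongRep.IsUnitary

theorem mem_unitary_of_norm_map {H X : Type*} [Group H] [NormedAddCommGroup X]
    [InnerProductSpace ℂ X] [CompleteSpace X] {ρ : H →* (X →L[ℂ] X)} {h : H}
    (hρ : ∀ x, ‖ρ h x‖ = ‖x‖) : ρ h ∈ unitary (X →L[ℂ] X) :=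
  ((Group.isUnit h).map ρ).mem_unitary_of_star_mul_self
    ((ContinuousLinearMap.norm_map_iff_adjoint_comp_self _).1 hρ)

section Modulation

variable {G : Type*} [CommGroup G] [TopologicalSpace G] [MeasurableSpace G] [BorelSpace G]
  (μ : Measure G) {p : ENNReal}

theorem memLp_top_pontryaginDual (χ : PontryaginDual G) : MemLp (fun s => (χ s : ℂ)) ⊤ μ :=
  memLp_top_of_bound (continuous_coe_pontryaginDual χ).aestronglyMeasurable 1
    (.of_forall fun s => (Circle.norm_coe (χ s)).le)

theorem coeFn_holder_pontryaginDual (χ : PontryaginDual G) (f : Lp ℂ p μ) :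
    (ContinuousLinearMap.mul ℂ ℂ).holder p (memLp_top_pontryaginDual μ χ).toLp f
      =ᵐ[μ] fun s => (χ s : ℂ) * f s := by
  filter_upwards [(ContinuousLinearMap.mul ℂ ℂ).coeFn_holder (r := p)
    (memLp_top_pontryaginDual μ χ).toLp f, (memLp_top_pontryaginDual μ χ).coeFn_toLp]
    with s h₁ h₂
  rw [h₁, h₂, ContinuousLinearMap.mul_apply']

variable [Fact (1 ≤ p)]

variable (p) in
/-- The action of the dual group on `Lᵖ(G)` by pointwise multiplication. It translates Fourier
transforms. -/
def modulation : PontryaginDual G →* (Lp ℂ p μ →L[ℂ] Lp ℂ p μ) where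
  toFun χ := (ContinuousLinearMap.mul ℂ ℂ).holderL μ ⊤ p p (memLp_top_pontryaginDual μ χ).toLp
  map_one' := by
    ext f
    filter_upwards [coeFn_holder_pontryaginDual μ 1 f] with s hs
    exact hs.trans (one_mul _)
  map_mul' χ ψ := by
    ext f
    filter_upwards [coeFn_holder_pontryaginDual μ (χ * ψ) f,
      coeFn_holder_pontryaginDual μ χ
        ((ContinuousLinearMap.mul ℂ ℂ).holder p (memLp_top_pontryaginDual μ ψ).toLp f),
      coeFn_holder_pontryaginDual μ ψ f] with s h₁ h₂ h₃
    exact h₁.trans ((mul_assoc (χ s : ℂ) _ _).trans ((congrArg _ h₃.symm).trans h₂.symm))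

theorem coeFn_modulation (χ : PontryaginDual G) (f : Lp ℂ p μ) :
    modulation μ p χ f =ᵐ[μ] fun s => (χ s : ℂ) * f s :=
  coeFn_holder_pontryaginDual μ χ f

theorem norm_modulation_apply (χ : PontryaginDual G) (f : Lp ℂ p μ) :
    ‖modulation μ p χ f‖ = ‖f‖ := by
  have hae : ∀ᵐ s ∂μ, ‖modulation μ p χ f s‖ = ‖f s‖ :=
    (coeFn_modulation μ χ f).mono fun s hs => by rw [hs, norm_mul, Circle.norm_coe, one_mul]
  exact le_antisymm (Lp.norm_le_norm_of_ae_le (hae.mono fun _ h => h.le))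
    (Lp.norm_le_norm_of_ae_le (hae.mono fun _ h => h.ge))

theorem modulation_mem_unitary (χ : PontryaginDual G) :
    modulation μ 2 χ ∈ unitary (Lp ℂ 2 μ →L[ℂ] Lp ℂ 2 μ) :=
  mem_unitary_of_norm_map (norm_modulation_apply μ χ)

theorem fourierL1_toL1_inner (f g : Lp ℂ 2 μ) (χ : PontryaginDual G) :
    fourierL1 μ ((L2.integrable_inner (𝕜 := ℂ) f g).toL1 _) χ =
      inner ℂ f (modulation μ 2 χ g) := by
  rw [fourierL1, L2.inner_def]
  refine integral_congr_ae ?_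
  filter_upwards [(L2.integrable_inner (𝕜 := ℂ) f g).coeFn_toL1, coeFn_modulation μ χ g]
    with s h₁ h₂
  rw [h₁, h₂, mul_comm, ← smul_eq_mul, ← smul_eq_mul, inner_smul_right, smul_eq_mul]

end Modulation

section Regular

variable {G : Type*} [CommGroup G] [TopologicalSpace G] [IsTopologicalGroup G]
  [LocallyCompactSpace G] [MeasurableSpace G] [BorelSpace G]
  (μ : Measure G) [μ.Regular] [μ.IsMulLeftInvariant]

/-- The regular representation `(T(s) f)(t) = f(s t)` of `G` on `L²(G)`. -/
def regularRep : StrongRep G (Lp ℂ 2 μ) where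
  toHom :=
    { toFun := fun s => (Lp.compMeasurePreservingₗᵢ ℂ (s • ·)
        (measurePreserving_smul s μ)).toContinuousLinearMap
      map_one' := by
        ext1 f
        exact one_smul Gᵈᵐᵃ f
      map_mul' := fun s t => by
        ext1 f
        rw [mul_comm s t]
        exact mul_smul (DomMulAct.mk s) (DomMulAct.mk t) f }
  continuous_apply := fun f => by
    have : Fact ((2 : ENNReal) ≠ ⊤) := ⟨ENNReal.ofNat_ne_top⟩
    exact (DomMulAct.continuous_mk (M := G)).smul (continuous_const (y := f))

theorem coeFn_regularRep (s : G) (f : Lp ℂ 2 μ) :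
    (regularRep μ).toHom s f =ᵐ[μ] fun t => f (s * t) :=
  DomMulAct.smul_Lp_ae_eq (DomMulAct.mk s) f

theorem isUnitary_regularRep : (regularRep μ).IsUnitary := fun s =>
  mem_unitary_of_norm_map fun f => DomMulAct.norm_smul_Lp (DomMulAct.mk s) f

theorem regularRep_mul_modulation (s : G) (χ : PontryaginDual G) :
    (regularRep μ).toHom s * modulation μ 2 χ =
      (χ s : ℂ) • (modulation μ 2 χ * (regularRep μ).toHom s) := by
  ext f
  rw [smul_apply, mul_apply_eq_comp, mul_apply_eq_comp]
  filter_upwards [coeFn_regularRep μ s (modulation μ 2 χ f),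
    (measurePreserving_mul_left μ s).quasiMeasurePreserving.ae (coeFn_modulation μ χ f),
    Lp.coeFn_smul (χ s : ℂ) (modulation μ 2 χ ((regularRep μ).toHom s f)),
    coeFn_modulation μ χ ((regularRep μ).toHom s f), coeFn_regularRep μ s f] with t h₁ h₂ h₃ h₄ h₅
  rw [h₁, h₂, h₃, Pi.smul_apply, h₄, h₅, smul_eq_mul, map_mul, Circle.coe_mul, mul_assoc]

theorem star_modulation_mul_regularRep_mul (s : G) (χ : PontryaginDual G) :
    star (modulation μ 2 χ) * (regularRep μ).toHom s * modulation μ 2 χ =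
      (χ s : ℂ) • (regularRep μ).toHom s := by
  rw [mul_assoc, regularRep_mul_modulation, mul_smul_comm, ← mul_assoc,
    Unitary.star_mul_self_of_mem (modulation_mem_unitary μ χ), one_mul]

end Regular

theorem nontrivial_Lp {α E : Type*} [TopologicalSpace α] [Nonempty α] [MeasurableSpace α]
    [OpensMeasurableSpace α] (μ : Measure α) [IsLocallyFiniteMeasure μ] [μ.IsOpenPosMeasure]
    [NormedAddCommGroup E] [Nontrivial E] {p : ENNReal} (hp : p ≠ 0) (hp' : p ≠ ⊤) :
    Nontrivial (Lp E p μ) := by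
  obtain ⟨c, hc⟩ := exists_ne (0 : E)
  obtain ⟨U, hxU, hU, hμU⟩ := μ.exists_isOpen_measure_lt_top (Classical.arbitrary α)
  refine ⟨indicatorConstLp p hU.measurableSet hμU.ne c, 0, fun h => ?_⟩
  have hμU' : 0 < μ.real U := ENNReal.toReal_pos (hU.measure_pos μ ⟨_, hxU⟩).ne' hμU.ne
  have hnorm := congrArg norm h
  rw [norm_indicatorConstLp hp hp', Lp.norm_zero] at hnorm
  exact mul_ne_zero (norm_ne_zero_iff.2 hc) (Real.rpow_pos_of_pos hμU' _).ne' hnorm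

theorem exists_isOpen_forall_div_mul_mem {Γ : Type*} [Group Γ] [TopologicalSpace Γ]
    [IsTopologicalGroup Γ] {x : Γ} {t : Set Γ} (ht : t ∈ 𝓝 x) (y : Γ) :
    ∃ V : Set Γ, IsOpen V ∧ y ∈ V ∧ ∀ v ∈ V, ∀ w ∈ V, v / w * x ∈ t := by
  have hcont : ContinuousAt (fun q : Γ × Γ => q.1 / q.2 * x) (y, y) := by fun_prop
  have hpre : (fun q : Γ × Γ => q.1 / q.2 * x) ⁻¹' t ∈ 𝓝 (y, y) :=
    hcont.preimage_mem_nhds (by simpa using ht)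
  obtain ⟨V, W, hV, hyV, hW, hyW, hVW⟩ := mem_nhds_prod_iff'.1 hpre
  exact ⟨V ∩ W, hV.inter hW, ⟨hyV, hyW⟩, fun v hv w hw =>
    hVW (Set.mk_mem_prod hv.1 hw.2)⟩

section Regularity

variable {G : Type*} [CommGroup G] [TopologicalSpace G] [IsTopologicalGroup G]
  [LocallyCompactSpace G] [MeasurableSpace G] [BorelSpace G]
  (μ : Measure G) [μ.Regular] [μ.IsMulLeftInvariant] [μ.IsOpenPosMeasure]

theorem gelfandSpectrum_regularRep_nonempty :
    (isUnitary_regularRep μ).gelfandSpectrum.Nonempty := by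
  have := nontrivial_Lp μ (E := ℂ) two_ne_zero ENNReal.ofNat_ne_top
  obtain ⟨a, ha⟩ := StrongRep.exists_hatOp_ne_zero μ (isUnitary_regularRep μ).isBounded
  obtain ⟨χ, hχ, -⟩ := (isUnitary_regularRep μ).exists_norm_fourierL1_eq μ ha
  exact ⟨χ, hχ⟩

theorem exists_mem_idealJ_fourierL1_ne_zero
    {Λ : Set (PontryaginDual G)} (hΛ : IsClosed Λ) {χ₀ : PontryaginDual G} (hχ₀ : χ₀ ∉ Λ) :
    ∃ b ∈ idealJ μ Λ, fourierL1 μ b χ₀ ≠ 0 := by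
  obtain ⟨χ₁, hχ₁⟩ := gelfandSpectrum_regularRep_nonempty μ
  obtain ⟨t, ht, htc, htΛ⟩ := exists_mem_nhds_isClosed_subset (hΛ.isOpen_compl.mem_nhds hχ₀)
  obtain ⟨V, hV, hχ₁V, hVt⟩ := exists_isOpen_forall_div_mul_mem ht χ₁
  obtain ⟨f, hf, horth⟩ :=
    (isUnitary_regularRep μ).exists_ne_zero_inner_eq_zero hV ⟨χ₁, hχ₁, hχ₁V⟩
  let b := (L2.integrable_inner (𝕜 := ℂ) f (modulation μ 2 χ₀⁻¹ f)).toL1 _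
  have hb (ψ : PontryaginDual G) :
      fourierL1 μ b ψ = inner ℂ f (modulation μ 2 (ψ / χ₀) f) := by
    rw [fourierL1_toL1_inner, ← mul_apply_eq_comp, ← map_mul, div_eq_mul_inv]
  refine ⟨b, fun χ hχ => ?_, ?_⟩
  · filter_upwards [htc.isOpen_compl.mem_nhds fun h => htΛ h hχ] with ψ hψ
    rw [hb]
    refine horth ⟨_, modulation_mem_unitary μ _⟩ (ψ / χ₀)
      (fun s => star_modulation_mul_regularRep_mul μ s _) fun η hη hη' => hψ ?_
    simpa using hVt _ hη' _ hη
  · rw [hb, div_self', map_one, one_apply_eq_self]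
    exact inner_self_ne_zero.2 hf

end Regularity

section Spectrum

variable {G : Type*} [CommGroup G] [TopologicalSpace G] [IsTopologicalGroup G]
  [LocallyCompactSpace G] [MeasurableSpace G] [BorelSpace G]
  {X : Type*} [NormedAddCommGroup X] [InnerProductSpace ℂ X] [CompleteSpace X]
  (μ : Measure G) [μ.Regular] [μ.IsMulLeftInvariant] {T : StrongRep G X} (hT : T.IsUnitary)

namespace StrongRep.IsUnitary

theorem gelfandSpectrum_subset_arvesonSpectrum [μ.IsOpenPosMeasure] :
    hT.gelfandSpectrum ⊆ T.arvesonSpectrum μ hT.isBounded := by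
  rintro χ hχ Λ ⟨hΛ, htop⟩
  by_contra h
  obtain ⟨b, hb, hbχ⟩ := exists_mem_idealJ_fourierL1_ne_zero μ hΛ h
  have hle := hT.norm_fourierL1_le μ b hχ
  rw [(spectralSubspace_eq_top_iff μ hT.isBounded).1 htop b hb, norm_zero] at hle
  exact hbχ (norm_le_zero_iff.1 hle)

theorem arvesonSpectrum_subset_closure_gelfandSpectrum :
    T.arvesonSpectrum μ hT.isBounded ⊆ closure hT.gelfandSpectrum := by
  refine Set.sInter_subset_of_mem ⟨isClosed_closure,
    (spectralSubspace_eq_top_iff μ hT.isBounded).2 fun b hb => ?_⟩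
  by_contra h
  obtain ⟨χ, hχ, hχb⟩ := hT.exists_norm_fourierL1_eq μ h
  rw [(hb χ (subset_closure hχ)).self_of_nhds, norm_zero] at hχb
  exact h (norm_eq_zero.1 hχb.symm)

theorem norm_fourierL1_le_of_mem_arvesonSpectrum (a : Lp ℂ 1 μ) {χ : PontryaginDual G}
    (hχ : χ ∈ T.arvesonSpectrum μ hT.isBounded) :
    ‖fourierL1 μ a χ‖ ≤ ‖T.hatOp μ hT.isBounded a‖ :=
  closure_minimal (fun _ h => hT.norm_fourierL1_le μ a h)
    (isClosed_le (continuous_fourierL1 a).norm continuous_const)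
    (hT.arvesonSpectrum_subset_closure_gelfandSpectrum μ hχ)

theorem exists_mem_arvesonSpectrum_norm_fourierL1_eq [μ.IsOpenPosMeasure] {a : Lp ℂ 1 μ}
    (ha : T.hatOp μ hT.isBounded a ≠ 0) :
    ∃ χ ∈ T.arvesonSpectrum μ hT.isBounded,
      ‖fourierL1 μ a χ‖ = ‖T.hatOp μ hT.isBounded a‖ :=
  let ⟨χ, hχ, hχa⟩ := hT.exists_norm_fourierL1_eq μ ha
  ⟨χ, hT.gelfandSpectrum_subset_arvesonSpectrum μ hχ, hχa⟩

end StrongRep.IsUnitary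

end Spectrum

end

theorem mainTheorem3_general {G : Type*} [CommGroup G] [TopologicalSpace G] [IsTopologicalGroup G]
    [LocallyCompactSpace G] [MeasurableSpace G] [BorelSpace G]
    (μ : Measure G) [μ.IsHaarMeasure] [μ.Regular]
    {X : Type*} [NormedAddCommGroup X] [InnerProductSpace ℂ X] [CompleteSpace X]
    (T : StrongRep G X) (hT : T.IsUnitary) (a : Lp ℂ 1 μ) :
    (BddAbove ((fun χ => ‖fourierL1 μ a χ‖) '' T.arvesonSpectrum μ hT.isBounded) ∧
      ‖T.hatOp μ hT.isBounded a‖ =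
        sSup ((fun χ => ‖fourierL1 μ a χ‖) '' T.arvesonSpectrum μ hT.isBounded)) ∧
    (T.hatOp μ hT.isBounded a = 0 ↔
      a ∈ idealK μ (T.arvesonSpectrum μ hT.isBounded)) := by
  have hle (χ) (hχ : χ ∈ T.arvesonSpectrum μ hT.isBounded) :=
    hT.norm_fourierL1_le_of_mem_arvesonSpectrum μ a hχ
  have hbdd : BddAbove ((fun χ => ‖fourierL1 μ a χ‖) '' T.arvesonSpectrum μ hT.isBounded) :=
    ⟨_, Set.forall_mem_image.2 hle⟩
  by_cases h0 : T.hatOp μ hT.isBounded a = 0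
  · have hzero : ∀ χ ∈ T.arvesonSpectrum μ hT.isBounded, fourierL1 μ a χ = 0 := fun χ hχ =>
      norm_le_zero_iff.1 ((hle χ hχ).trans_eq (by rw [h0, norm_zero]))
    refine ⟨⟨hbdd, le_antisymm ?_ (Real.sSup_le (Set.forall_mem_image.2 hle) (norm_nonneg _))⟩,
      fun _ => hzero, fun _ => h0⟩
    rw [h0, norm_zero]
    exact Real.sSup_nonneg (Set.forall_mem_image.2 fun _ _ => norm_nonneg _)
  · obtain ⟨χ, hχ, hχa⟩ := hT.exists_mem_arvesonSpectrum_norm_fourierL1_eq μ h0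
    have hmax : IsGreatest ((fun χ => ‖fourierL1 μ a χ‖) '' T.arvesonSpectrum μ hT.isBounded)
        ‖T.hatOp μ hT.isBounded a‖ := ⟨⟨χ, hχ, hχa⟩, Set.forall_mem_image.2 hle⟩
    exact ⟨⟨hbdd, hmax.csSup_eq.symm⟩, fun h => absurd h h0, fun h =>
      norm_eq_zero.1 (hχa ▸ norm_eq_zero.2 (h χ hχ))⟩

theorem mainTheorem3 {G : Type*} [CommGroup G] [TopologicalSpace G] [IsTopologicalGroup G]
    [LocallyCompactSpace G] [T2Space G] [MeasurableSpace G] [BorelSpace G]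
    (μ : Measure G) [μ.IsHaarMeasure] [μ.Regular]
    {X : Type*} [NormedAddCommGroup X] [InnerProductSpace ℂ X] [CompleteSpace X]
    (T : StrongRep G X) (hT : T.IsUnitary) (a : Lp ℂ 1 μ) :
    (BddAbove ((fun χ => ‖fourierL1 μ a χ‖) '' T.arvesonSpectrum μ hT.isBounded) ∧
      ‖T.hatOp μ hT.isBounded a‖ =
        sSup ((fun χ => ‖fourierL1 μ a χ‖) '' T.arvesonSpectrum μ hT.isBounded)) ∧
    (T.hatOp μ hT.isBounded a = 0 ↔
      a ∈ idealK μ (T.arvesonSpectrum μ hT.isBounded)) :=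
  mainTheorem3_general μ T hT a
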